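/- **Theorem 5.1.** Let $(\Omega,\mathcal F,\Pr)$ be a probability space and $(\mathcal F_n)_{n\ge 0}$ an increasing sequence of sub-$\sigma$-fields of $\mathcal F$ with $\mathcal F_0$ trivial (every set in it has probability $0$ or $1$). A sequence $(f_n)_{n\ge1}$ of random variables with values in a measurable space $(S,\mathcal S)$, where each $f_n$ is $\mathcal F_n$-measurable, satisfies *condition (C.I.)* if there is a $\sigma$-field $\mathcal G\subset\mathcal F$ such that, almost surely, $E(I_{(f_n\in A)}\mid\mathcal F_{n-1})=E(I_{(f_n\in A)}\mid\mathcal G)$ for all $n\ge1$ and $A\in\mathcal S$, and $$E(I_{(f_1\in A_1)}\cdots I_{(f_n\in A_n)}\mid\mathcal G)=E(I_{(f_1\in A_1)}\mid\mathcal G)\cdots E(I_{(f_n\in A_n)}\mid\mathcal G)$$ for all $n\ge 1$ and $A_1,\dots,A_n\in\mathcal S$. Let $\lambda$ denote Lebesgue measure on $[0,1]^n$ and (as product measure) on $[0,1]^{\mathbb N}$. 1. Let $(S,\mathcal S)$ be a separable measurable space, i.e. $\mathcal S$ is generated by countably many sets, and let $(f_n)$ be an $S$-valued sequence adapted to $(\mathcal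 F_n)$ that satisfies condition (C.I.). Suppose that the law $\mu$ of each $f_n$ is a perfect measure, that is, for every measurable $\varphi:S\to\mathbb R$ there is a Borel set $B\subset\varphi(S)$ with $\mu(\varphi\notin B)=0$ (this is automatic if $(S,\mathcal S)$ is a standard Borel space). Then there are Borel measurable functions $h_n:[0,1]^n\to S$, $n\ge1$, such that if $$u_n((x_k),(y_k))=h_n(x_1,\dots,x_{n-1},y_n)\qquad\text{on }[0,1]^{\mathbb N}\times[0,1]^{\mathbb N},$$ then the sequences $(f_n)$ on $(\Omega,\Pr)$, $(h_n(x_1,\dots,x_n))$ on $([0,1]^{\mathbb N},\lambda)$ and $(u_n)$ on $([0,1]^{\mathbb N}\times[0,1]^{\mathbb N},\lambda\otimes\lambda)$ have the same law on $S^{\mathbb N}$. 2. Let $S$ be a separable Banach space with its Borel $\sigma$-field, and let $(f_n)$ be an $S$-valued sequence adapted to $(\mathcal F_n)$ that satisfies condition (C.I.). Then there are $(h_n)$ as in part 1 such that, if moreover $(f_n)$ is a martingale difference sequence with respect to $(\mathcal F_n)$ (each $f_n$ is Bochner integrable and $E(f_n\mid\mathcal F_{n-1})=0$ almost surely for $n\ge1$),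 then for every $n\ge1$ and almost all $(x_1,\dots,x_{n-1})\in[0,1]^{n-1}$ the function $h_n(x_1,\dots,x_{n-1},\cdot)$ is Bochner integrable and $$\int_0^1 h_n(x_1,\dots,x_n)\,dx_n=0 .$$ -/

import Mathlib

open MeasureTheory ProbabilityTheory

/-- Lebesgue measure on the infinite cube `[0,1]^ℕ`: the countable product of Lebesgue measure
on `[0,1]`. -/
noncomputable def cubeMeasure : Measure (ℕ → unitInterval) :=
  Measure.infinitePi (fun _ : ℕ => (volume : Measure unitInterval))

/-- The σ-field `𝒜` is trivial for the probability measure `P` (it may contain null sets). -/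
def IsTrivialField {Ω : Type*} [MeasurableSpace Ω] (P : Measure Ω) (𝒜 : MeasurableSpace Ω) :
    Prop :=
  ∀ s : Set Ω, MeasurableSet[𝒜] s → P s = 0 ∨ P s = 1

/-- A random sequence `f₁, f₂, …` is indexed from `0` below: `f n` stands for `f_{n+1}`.
The sequence is adapted to `(ℱ_n)_{n ≥ 0}` if `f_{n+1}` is `ℱ_{n+1}`-measurable. -/
def IsAdaptedSeq {Ω S : Type*} [mΩ : MeasurableSpace Ω] [MeasurableSpace S]
    (ℱ : Filtration ℕ mΩ) (f : ℕ → Ω → S) : Prop :=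
  ∀ n : ℕ, Measurable[ℱ (n + 1)] (f n)

/-- The indicator random variable `I_{(X ∈ A)}`. -/
noncomputable def indIn {Ω S : Type*} (X : Ω → S) (A : Set S) : Ω → ℝ :=
  (X ⁻¹' A).indicator (fun _ => (1 : ℝ))

/-- Condition (C.I.) for the sequence `f`, with `f n` standing for `f_{n+1}`: there is a σ-field
`𝒢` such that the law of `f_{n+1}` conditionally on `ℱ_n` is its law conditionally on `𝒢`, and
such that the sequence is conditionally independent with respect to `𝒢`. -/
def ConditionCI {Ω S : Type*} [mΩ : MeasurableSpace Ω] [MeasurableSpace S]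
    (P : Measure Ω) (ℱ : Filtration ℕ mΩ) (f : ℕ → Ω → S) : Prop :=
  ∃ 𝒢 : MeasurableSpace Ω, 𝒢 ≤ mΩ ∧
    (∀ (n : ℕ) (A : Set S), MeasurableSet A →
      P[indIn (f n) A | ℱ n] =ᵐ[P] P[indIn (f n) A | 𝒢]) ∧
    (∀ (n : ℕ) (A : ℕ → Set S), (∀ k, MeasurableSet (A k)) →
      P[fun ω => ∏ k ∈ Finset.range n, indIn (f k) (A k) ω | 𝒢]
        =ᵐ[P] fun ω => ∏ k ∈ Finset.range n, (P[indIn (f k) (A k) | 𝒢]) ω)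

/-- A perfect measure: for every measurable real function `φ`, the range of `φ` contains
a Borel set of full measure for the image measure. Every finite measure on a standard Borel
space, in particular on a Polish space, is perfect. -/
def IsPerfectMeasure {S : Type*} [MeasurableSpace S] (μ : Measure S) : Prop :=
  ∀ φ : S → ℝ, Measurable φ →
    ∃ B : Set ℝ, MeasurableSet B ∧ B ⊆ Set.range φ ∧ μ (φ ⁻¹' Bᶜ) = 0

/-- `(f_n)_{n ≥ 1}` is a (Bochner integrable) martingale difference sequence with respect to
`(ℱ_n)_{n ≥ 0}`, with `f n` standing for `f_{n+1}`. -/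
def IsMartingaleDifference {Ω E : Type*} [mΩ : MeasurableSpace Ω] [NormedAddCommGroup E]
    [NormedSpace ℝ E] [CompleteSpace E] [MeasurableSpace E]
    (P : Measure Ω) (ℱ : Filtration ℕ mΩ) (f : ℕ → Ω → E) : Prop :=
  IsAdaptedSeq ℱ f ∧ ∀ n : ℕ, Integrable (f n) P ∧ P[f n | ℱ n] =ᵐ[P] 0

/-- The lifting to `[0,1]^ℕ` of a sequence `h_n : [0,1]^n → S` (`h n` standing for `h_{n+1}`):
`(x) ↦ (h_n(x_1, …, x_n))_n`. -/
def liftSeq {S : Type*} (h : (n : ℕ) → (Fin (n + 1) → unitInterval) → S)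
    (x : ℕ → unitInterval) : ℕ → S :=
  fun n => h n (fun i : Fin (n + 1) => x i)

/-- The sequence `u_n((x), (y)) = h_n(x_1, …, x_{n-1}, y_n)` on `[0,1]^ℕ × [0,1]^ℕ`. -/
def decoupledSeq {S : Type*} (h : (n : ℕ) → (Fin (n + 1) → unitInterval) → S)
    (z : (ℕ → unitInterval) × (ℕ → unitInterval)) : ℕ → S :=
  fun n => h n (Fin.snoc (α := fun _ => unitInterval) (fun i : Fin n => z.1 i) (z.2 n))

/-- `(h_n)` is a sequence of measurable functions `h_n : [0,1]^n → S` such that the laws of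
`(f_n)`, `(h_n)` and `(u_n)`, as random elements of `S^ℕ`, are the same. -/
def RepresentsCI {Ω S : Type*} [MeasurableSpace Ω] [MeasurableSpace S] (P : Measure Ω)
    (f : ℕ → Ω → S) (h : (n : ℕ) → (Fin (n + 1) → unitInterval) → S) : Prop :=
  (∀ n, Measurable (h n)) ∧
    IdentDistrib (fun ω n => f n ω) (liftSeq h) P cubeMeasure ∧
    IdentDistrib (fun ω n => f n ω) (decoupledSeq h) P (cubeMeasure.prod cubeMeasure)

/-!
The law of `f_n` given `ℱ_{n-1}` is a random measure `M_n`, which is `ℱ_{n-1}`-measurable. The past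
values of `f` alone need not determine it, so the recursion that produces `h_n` runs over a richer
sequence: `g_n = (f_n, W_{n+1})`, where `W_{n+1}` encodes `M_{n+1}` by its values on a countable
generating algebra (`exists_measurable_code`). When the target of `f` is standard Borel, so is that
of `g`, and the conditional law of `g_n` given `g_1, …, g_{n-1}` is sampled by a measurable function
`q_n` of the past and of a uniform variable. Running this recursion (`unroll`) on independent
uniform variables gives a copy of `g` (`map_unrollSeq`), and `h_n` is the first component of its
`n`-th value.

Since `W_n` is among the past values of `g`, and `ℱ_0` is trivial, conditioning `f_n` on the past of
`g` is conditioning it on `ℱ_{n-1}` (`condExp_comap_initSeg_ae_eq`). The terms of the decoupled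
sequence are independent given the first family of uniform variables, hence the probability that it
lies in a box `∏ A_k` is `E ∏ P(f_k ∈ A_k | ℱ_{k-1}) = E ∏ P(f_k ∈ A_k | 𝒢)`, which by conditional
independence is `E P(f_k ∈ A_k for all k | 𝒢)`, the probability that `f` itself lies in the box
(`decoupledSeq_unrollFst_box`, `ConditionCI.integral_prod_condExp`).

For a countably generated space `S` one takes `φ : S → ℝ` generating the σ-field. Perfectness of the
laws provides almost everywhere defined measurable sections of `φ`
(`IsPerfectMeasure.exists_section`), which pull a representation of `φ(f_n)` back to `S`.

In the Banach space case, for almost every `x` the law of `h_n(x_1, …, x_{n-1}, ·)` is a conditional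
law of `f_n` given an `ℱ_{n-1}`-measurable variable. Its mean is a value of the conditional
expectation of `f_n`, and vanishes when `f` is a martingale difference sequence
(`ae_integral_condDistrib_eq_zero`).
-/

open scoped unitInterval ENNReal

/-! ### Laws on sequence spaces -/

/-- The initial segment of length `n` of a sequence. -/
def initSeg {α : Type*} (n : ℕ) (x : ℕ → α) : Fin n → α := fun i => x i

lemma measurable_initSeg {α : Type*} [MeasurableSpace α] (n : ℕ) :
    Measurable (initSeg n : (ℕ → α) → Fin n → α) :=
  measurable_pi_lambda _ fun i => measurable_pi_apply (i : ℕ)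

lemma initSeg_succ {α : Type*} (n : ℕ) (x : ℕ → α) :
    initSeg (n + 1) x = Fin.snoc (α := fun _ => α) (initSeg n x) (x n) := by
  funext i
  refine Fin.lastCases ?_ (fun j => ?_) i
  · simp [initSeg]
  · simp [initSeg]

lemma measurable_snoc {α : Type*} [MeasurableSpace α] (n : ℕ) :
    Measurable (fun p : (Fin n → α) × α => Fin.snoc (α := fun _ => α) p.1 p.2) := by
  refine measurable_pi_lambda _ fun i => ?_
  refine Fin.lastCases ?_ (fun j => ?_) i
  · simpa using measurable_snd
  · simpa using! (measurable_pi_apply j).comp measurable_fst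

/-- Two finite measures on a sequence space agree if they agree on boxes constraining finitely many
coordinates. -/
lemma ext_of_forall_box {α : Type*} [MeasurableSpace α] {μ ν : Measure (ℕ → α)}
    [IsFiniteMeasure μ]
    (h : ∀ (N : ℕ) (A : ℕ → Set α), (∀ k, MeasurableSet (A k)) →
      μ {x | ∀ k ∈ Finset.range N, x k ∈ A k} = ν {x | ∀ k ∈ Finset.range N, x k ∈ A k}) :
    μ = ν := by
  classical
  refine ext_of_generate_finite
    (squareCylinders fun _ : ℕ => {s : Set α | MeasurableSet s})
    (generateFrom_squareCylinders).symm
    (isPiSystem_squareCylinders (fun _ => MeasurableSpace.isPiSystem_measurableSet)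
      (fun _ => MeasurableSet.univ)) ?_ ?_
  · rintro _ ⟨s, t, ht, rfl⟩
    obtain ⟨N, hN⟩ := s.exists_nat_subset_range
    have key : (s : Set ℕ).pi t =
        {x : ℕ → α | ∀ k ∈ Finset.range N, x k ∈ if k ∈ s then t k else Set.univ} := by
      ext x
      simp only [Set.mem_pi, Finset.mem_coe, Set.mem_ofPred_eq]
      constructor
      · intro hx k _
        split_ifs with hk
        · exact hx k hk
        · trivial
      · intro hx k hk
        simpa [hk] using hx k (hN hk)
    rw [key]
    refine h N _ fun k => ?_
    split_ifs
    · exact ht k trivial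
    · exact MeasurableSet.univ
  · simpa using h 0 (fun _ => Set.univ) fun _ => MeasurableSet.univ

lemma measurableSet_box {α : Type*} [MeasurableSpace α] (N : ℕ) {A : ℕ → Set α}
    (hA : ∀ k, MeasurableSet (A k)) :
    MeasurableSet {x : ℕ → α | ∀ k ∈ Finset.range N, x k ∈ A k} := by
  have : {x : ℕ → α | ∀ k ∈ Finset.range N, x k ∈ A k} = (Finset.range N : Set ℕ).pi A := by
    ext; simp [Set.mem_pi]
  rw [this]
  exact MeasurableSet.pi (Finset.range N).countable_toSet fun k _ => hA k

/-- Two finite measures on a sequence space agree if their finite-dimensional laws do. -/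
lemma ext_of_forall_map_initSeg {α : Type*} [MeasurableSpace α] {μ ν : Measure (ℕ → α)}
    [IsFiniteMeasure μ] (h : ∀ N, μ.map (initSeg N) = ν.map (initSeg N)) : μ = ν := by
  refine ext_of_forall_box fun N A hA => ?_
  have key : {x : ℕ → α | ∀ k ∈ Finset.range N, x k ∈ A k} =
      initSeg N ⁻¹' Set.univ.pi fun i : Fin N => A i := by
    ext x
    simp only [Set.mem_ofPred_eq, Finset.mem_range, Set.mem_preimage, Set.mem_univ_pi, initSeg]
    exact ⟨fun hx i => hx i i.2, fun hx k hk => hx ⟨k, hk⟩⟩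
  have hm : MeasurableSet (Set.univ.pi fun i : Fin N => A i) :=
    MeasurableSet.univ_pi fun i => hA i
  rw [key, ← Measure.map_apply (measurable_initSeg N) hm, h N,
    Measure.map_apply (measurable_initSeg N) hm]

instance : IsProbabilityMeasure cubeMeasure := by
  unfold cubeMeasure; infer_instance

lemma cubeMeasure_box (N : ℕ) {A : ℕ → Set I} (hA : ∀ k, MeasurableSet (A k)) :
    cubeMeasure {x | ∀ k ∈ Finset.range N, x k ∈ A k} = ∏ k ∈ Finset.range N, volume (A k) := by
  have : {x : ℕ → I | ∀ k ∈ Finset.range N, x k ∈ A k} = (Finset.range N : Set ℕ).pi A := by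
    ext; simp [Set.mem_pi]
  rw [this, cubeMeasure, Measure.infinitePi_pi _ fun k _ => hA k]

lemma map_initSeg_cubeMeasure (n : ℕ) :
    cubeMeasure.map (initSeg n) = (volume : Measure (Fin n → I)) := by
  refine (Measure.pi_eq fun s hs => ?_).symm
  rw [Measure.map_apply (measurable_initSeg n) (MeasurableSet.univ_pi hs)]
  let A : ℕ → Set I := fun k => if h : k < n then s ⟨k, h⟩ else Set.univ
  have hA : ∀ k, MeasurableSet (A k) := by
    intro k
    by_cases h : k < n
    · simpa [A, h] using hs ⟨k, h⟩
    · simp [A, h]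
  have : initSeg n ⁻¹' Set.univ.pi s = {x : ℕ → I | ∀ k ∈ Finset.range n, x k ∈ A k} := by
    ext x
    simp only [Set.mem_preimage, Set.mem_univ_pi, Set.mem_ofPred_eq, Finset.mem_range, initSeg]
    constructor
    · intro h k hk
      simpa [A, hk] using h ⟨k, hk⟩
    · intro h i
      simpa [A] using h i i.2
  rw [this, cubeMeasure_box n hA, Finset.prod_range]
  exact Finset.prod_congr rfl fun i _ => by simp [A]

lemma map_snoc_volume (n : ℕ) :
    ((volume : Measure (Fin n → I)).prod (volume : Measure I)).map
      (fun p => Fin.snoc (α := fun _ => I) p.1 p.2) = volume := by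
  have h := (volume_preserving_piFinSuccAbove (fun _ : Fin (n + 1) => I) (Fin.last n)).symm
  rw [← h.map_eq]
  have h2 : (volume : Measure (I × (Fin n → I))) =
      ((volume : Measure (Fin n → I)).prod (volume : Measure I)).map Prod.swap :=
    (Measure.prod_swap).symm
  rw [show (volume : Measure (I × ((i : Fin n) → I))) = _ from h2,
    Measure.map_map (MeasurableEquiv.measurable _) measurable_swap]
  congr 1
  funext p
  simp [MeasurableEquiv.piFinSuccAbove, Fin.insertNthEquiv]

/-! ### Recursions driven by uniform variables -/

section Unroll

variable {T : Type*}

/-- The recursion driven by the maps `q n`: from the numbers `x₀, …, x_{n-1}` it produces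
`y₀, …, y_{n-1}`, where `y_k = q k (y₀, …, y_{k-1}) x_k`. -/
def unroll (q : (n : ℕ) → (Fin n → T) → I → T) : (n : ℕ) → (Fin n → I) → Fin n → T
  | 0, _ => Fin.elim0
  | n + 1, x => Fin.snoc (α := fun _ => T) (unroll q n (Fin.init x))
      (q n (unroll q n (Fin.init x)) (x (Fin.last n)))

lemma unroll_snoc (q : (n : ℕ) → (Fin n → T) → I → T) (n : ℕ) (x : Fin n → I) (t : I) :
    unroll q (n + 1) (Fin.snoc (α := fun _ => I) x t) =
      Fin.snoc (α := fun _ => T) (unroll q n x) (q n (unroll q n x) t) := by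
  simp [unroll]

/-- The recursion is consistent: its first `k` outputs depend on the first `k` inputs only. -/
lemma unroll_initSeg_apply (q : (n : ℕ) → (Fin n → T) → I → T) (x : ℕ → I) (n : ℕ) (i : Fin n) :
    unroll q n (initSeg n x) i = unroll q (i + 1) (initSeg (i + 1) x) (Fin.last i) := by
  induction n with
  | zero => exact i.elim0
  | succ n ih =>
    refine Fin.lastCases ?_ (fun j => ?_) i
    · rfl
    · rw [initSeg_succ, unroll_snoc, Fin.snoc_castSucc]
      exact ih j

variable [MeasurableSpace T]

lemma measurable_unroll {q : (n : ℕ) → (Fin n → T) → I → T}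
    (hq : ∀ n, Measurable (Function.uncurry (q n))) (n : ℕ) : Measurable (unroll q n) := by
  induction n with
  | zero => exact measurable_pi_lambda _ fun i => i.elim0
  | succ n ih =>
    have h1 : Measurable (fun x : Fin (n + 1) → I => unroll q n (Fin.init x)) :=
      ih.comp (measurable_pi_lambda _ fun i => measurable_pi_apply _)
    exact (measurable_snoc n).comp
      (h1.prodMk ((hq n).comp (h1.prodMk (measurable_pi_apply (Fin.last n)))))

/-- Sampling from a kernel by means of a uniform variable: if `q y` pushes Lebesgue measure to
`κ y`, then `(y, t) ↦ (y, q y t)` pushes `ν ⊗ λ` to `ν ⊗ₘ κ`. -/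
lemma map_prod_uniform {Y : Type*} [MeasurableSpace Y] (ν : Measure Y) [IsFiniteMeasure ν]
    (κ : Kernel Y T) [IsMarkovKernel κ] {q : Y → I → T} (hq : Measurable (Function.uncurry q))
    (hqκ : ∀ y, volume.map (q y) = κ y) :
    (ν.prod (volume : Measure I)).map (fun p => (p.1, q p.1 p.2)) = ν ⊗ₘ κ := by
  have hm : Measurable (fun p : Y × I => (p.1, q p.1 p.2)) := measurable_fst.prodMk hq
  ext s hs
  rw [Measure.map_apply hm hs, Measure.prod_apply (hm hs), Measure.compProd_apply hs]
  refine lintegral_congr fun y => ?_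
  rw [← hqκ y, Measure.map_apply hq.of_uncurry_left (measurable_prodMk_left hs)]
  rfl

/-- If `q n y` samples the conditional law of `g n` given `(g 0, …, g (n - 1)) = y`, then the
recursion driven by `q` reproduces the finite-dimensional laws of `g`. -/
lemma map_unroll {Ω : Type*} [MeasurableSpace Ω] {P : Measure Ω} [IsProbabilityMeasure P]
    [StandardBorelSpace T] [Nonempty T] {g : ℕ → Ω → T} (hg : ∀ n, Measurable (g n))
    {q : (n : ℕ) → (Fin n → T) → I → T} (hq : ∀ n, Measurable (Function.uncurry (q n)))
    (hqκ : ∀ n y, volume.map (q n y) =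
      condDistrib (g n) (fun ω => initSeg n fun k => g k ω) P y) (n : ℕ) :
    (volume : Measure (Fin n → I)).map (unroll q n) =
      P.map (fun ω => initSeg n fun k => g k ω) := by
  have hp : ∀ n, Measurable (fun ω => initSeg n fun k => g k ω) := fun n =>
    (measurable_initSeg n).comp (measurable_pi_lambda _ hg)
  induction n with
  | zero =>
    -- Both sides are probability measures on a one-point space.
    have : IsProbabilityMeasure (P.map (fun ω => initSeg 0 fun k => g k ω)) :=
      Measure.isProbabilityMeasure_map (hp 0).aemeasurable
    have : IsProbabilityMeasure ((volume : Measure (Fin 0 → I)).map (unroll q 0)) :=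
      Measure.isProbabilityMeasure_map (measurable_unroll hq 0).aemeasurable
    ext s _
    rcases Set.eq_empty_or_nonempty s with rfl | hs
    · simp
    · rw [Subsingleton.eq_univ_of_nonempty hs, measure_univ, measure_univ]
  | succ n ih =>
    have hu := measurable_unroll hq
    have hstep : Measurable (fun p : (Fin n → T) × I => (p.1, q n p.1 p.2)) :=
      measurable_fst.prodMk (hq n)
    calc (volume : Measure (Fin (n + 1) → I)).map (unroll q (n + 1))
        = ((volume : Measure (Fin n → I)).prod (volume : Measure I)).map
            (fun p => Fin.snoc (α := fun _ => T) (unroll q n p.1)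
              (q n (unroll q n p.1) p.2)) := by
          rw [← map_snoc_volume, Measure.map_map (hu _) (measurable_snoc n)]
          congr 1
          funext p
          exact unroll_snoc q n p.1 p.2
      _ = ((((volume : Measure (Fin n → I)).map (unroll q n)).prod (volume : Measure I)).map
            (fun p => (p.1, q n p.1 p.2))).map
              (fun p => Fin.snoc (α := fun _ => T) p.1 p.2) := by
          have : ((volume : Measure (Fin n → I)).map (unroll q n)).prod (volume : Measure I) =
              ((volume : Measure (Fin n → I)).prod (volume : Measure I)).map
                (Prod.map (unroll q n) id) := by
            rw [← Measure.map_prod_map _ _ (hu n) measurable_id, Measure.map_id]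
          rw [this, Measure.map_map hstep ((hu n).prodMap measurable_id),
            Measure.map_map (measurable_snoc n) (hstep.comp ((hu n).prodMap measurable_id))]
          rfl
      _ = (P.map (fun ω => (initSeg n fun k => g k ω, g n ω))).map
              (fun p => Fin.snoc (α := fun _ => T) p.1 p.2) := by
          have : IsProbabilityMeasure (P.map (fun ω => initSeg n fun k => g k ω)) :=
            Measure.isProbabilityMeasure_map (hp n).aemeasurable
          rw [ih, map_prod_uniform _ _ (hq n) (hqκ n),
            compProd_map_condDistrib (hg n).aemeasurable]
      _ = P.map (fun ω => initSeg (n + 1) fun k => g k ω) := by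
          rw [Measure.map_map (measurable_snoc n) ((hp n).prodMk (hg n))]
          congr 1
          funext ω
          exact (initSeg_succ n fun k => g k ω).symm

end Unroll

section UnrollSeq

variable {T : Type*}

/-- The infinite version of `unroll`: the sequence `y_n = q n (y₀, …, y_{n-1}) x_n`. -/
def unrollSeq (q : (n : ℕ) → (Fin n → T) → I → T) (x : ℕ → I) (n : ℕ) : T :=
  unroll q (n + 1) (initSeg (n + 1) x) (Fin.last n)

lemma initSeg_unrollSeq (q : (n : ℕ) → (Fin n → T) → I → T) (x : ℕ → I) (n : ℕ) :
    initSeg n (unrollSeq q x) = unroll q n (initSeg n x) :=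
  funext fun i => (unroll_initSeg_apply q x n i).symm

variable [MeasurableSpace T]

lemma measurable_unrollSeq {q : (n : ℕ) → (Fin n → T) → I → T}
    (hq : ∀ n, Measurable (Function.uncurry (q n))) : Measurable (unrollSeq q) :=
  measurable_pi_lambda _ fun n => (measurable_pi_apply (Fin.last n)).comp
    ((measurable_unroll hq (n + 1)).comp (measurable_initSeg (n + 1)))

lemma map_unrollSeq {Ω : Type*} [MeasurableSpace Ω] {P : Measure Ω} [IsProbabilityMeasure P]
    [StandardBorelSpace T] [Nonempty T] {g : ℕ → Ω → T} (hg : ∀ n, Measurable (g n))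
    {q : (n : ℕ) → (Fin n → T) → I → T} (hq : ∀ n, Measurable (Function.uncurry (q n)))
    (hqκ : ∀ n y, volume.map (q n y) =
      condDistrib (g n) (fun ω => initSeg n fun k => g k ω) P y) :
    cubeMeasure.map (unrollSeq q) = P.map (fun ω k => g k ω) := by
  have hq' := measurable_unrollSeq hq
  refine ext_of_forall_map_initSeg fun N => ?_
  rw [Measure.map_map (measurable_initSeg N) hq',
    Measure.map_map (measurable_initSeg N) (measurable_pi_lambda _ hg)]
  calc cubeMeasure.map (initSeg N ∘ unrollSeq q)
      = (cubeMeasure.map (initSeg N)).map (unroll q N) := by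
        rw [Measure.map_map (measurable_unroll hq N) (measurable_initSeg N)]
        exact congrArg (fun F => cubeMeasure.map F) (funext fun x => initSeg_unrollSeq q x N)
    _ = P.map (fun ω => initSeg N fun k => g k ω) := by
        rw [map_initSeg_cubeMeasure, map_unroll hg hq hqκ N]

end UnrollSeq

/-! ### Conditional laws given a σ-field -/

section CondExp

variable {Ω : Type*} {m mΩ : MeasurableSpace Ω} {P : Measure Ω} [IsProbabilityMeasure P]

/-- If `P[X | m₂]` has a version that is measurable for the smaller σ-field `m₁`, then it is also
`P[X | m₁]`. -/
lemma condExp_ae_eq_of_le {m₁ m₂ : MeasurableSpace Ω} (h₁₂ : m₁ ≤ m₂) (h₂ : m₂ ≤ mΩ)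
    {X Y : Ω → ℝ} (hY : StronglyMeasurable[m₁] Y) (h : Y =ᵐ[P] P[X | m₂]) :
    P[X | m₁] =ᵐ[P] P[X | m₂] := by
  have hYi : Integrable Y P := integrable_condExp.congr h.symm
  have h1 : P[P[X | m₂] | m₁] =ᵐ[P] P[X | m₁] := condExp_condExp_of_le h₁₂ h₂
  have h2 : P[Y | m₁] =ᵐ[P] P[P[X | m₂] | m₁] := condExp_congr_ae h
  rw [condExp_of_stronglyMeasurable (h₁₂.trans h₂) hY hYi] at h2
  exact (h2.trans h1).symm.trans h

/-- A trivial σ-field is independent of everything, so conditioning on it gives the mean. -/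
lemma IsTrivialField.condExp_ae_eq (hm : m ≤ mΩ)
    (htriv : IsTrivialField P m) {X : Ω → ℝ} (hX : StronglyMeasurable X) :
    P[X | m] =ᵐ[P] fun _ => ∫ ω, X ω ∂P := by
  refine condExp_indep_eq le_rfl hm hX ?_
  rw [Indep_iff]
  intro s t _ ht
  rcases htriv t ht with h0 | h1
  · rw [h0, mul_zero]
    exact measure_mono_null Set.inter_subset_right h0
  · have htc : P tᶜ = 0 := (prob_compl_eq_zero_iff (hm t ht)).2 h1
    rw [h1, mul_one]
    refine le_antisymm (measure_mono Set.inter_subset_left) ?_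
    calc P s ≤ P (s ∩ t ∪ tᶜ) := measure_mono fun ω hω => by
            by_cases h : ω ∈ t
            · exact Or.inl ⟨hω, h⟩
            · exact Or.inr h
      _ ≤ P (s ∩ t) + P tᶜ := measure_union_le _ _
      _ = P (s ∩ t) := by rw [htc, add_zero]

variable {Z : Type*} [MeasurableSpace Z] [StandardBorelSpace Z] [Nonempty Z]

/-- Regular conditional laws given a σ-field, measurable for that σ-field as measure-valued
maps. -/
lemma exists_condLaw (hm : m ≤ mΩ) {Y : Ω → Z} (hY : Measurable Y) :
    ∃ M : Ω → Measure Z, (∀ ω, IsProbabilityMeasure (M ω)) ∧ Measurable[m] M ∧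
      ∀ A, MeasurableSet A → (fun ω => (M ω).real A) =ᵐ[P] P[indIn Y A | m] := by
  have hid : Measurable[mΩ, m] (id : Ω → Ω) := measurable_id'' hm
  let κ : @Kernel Ω Z m _ := @condDistrib Ω Ω Z _ _ _ mΩ m Y id P _
  have : IsMarkovKernel κ := by infer_instance
  refine ⟨fun ω => κ ω, fun ω => inferInstance, κ.measurable, fun A hA => ?_⟩
  have h := condDistrib_ae_eq_condExp (mβ := m) (μ := P) hid hY hA
  rw [MeasurableSpace.comap_id] at h
  exact h

/-- The conditional law of `Y` given `m` depends on `m` only through a random element `W` of a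
standard Borel space, namely the values of the conditional law on a countable generating
algebra. -/
lemma exists_measurable_code (hm : m ≤ mΩ) {Y : Ω → Z}
    (hY : Measurable Y) :
    ∃ W : Ω → ℕ → ℝ≥0∞, Measurable[m] W ∧ ∀ A, MeasurableSet A →
      ∃ X : Ω → ℝ, StronglyMeasurable[MeasurableSpace.comap W inferInstance] X ∧
        X =ᵐ[P] P[indIn Y A | m] := by
  obtain ⟨M, hM, hMm, hMA⟩ := exists_condLaw (P := P) hm hY
  let 𝒞 : Set (Set Z) := generateSetAlgebra (MeasurableSpace.countableGeneratingSet Z)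
  have halg : IsSetAlgebra 𝒞 := isSetAlgebra_generateSetAlgebra
  have hgen : MeasurableSpace.generateFrom 𝒞 = ‹MeasurableSpace Z› := by
    rw [generateFrom_generateSetAlgebra_eq, MeasurableSpace.generateFrom_countableGeneratingSet]
  have hcount : 𝒞.Countable :=
    countable_generateSetAlgebra MeasurableSpace.countable_countableGeneratingSet
  obtain ⟨e, he⟩ := hcount.exists_eq_range ⟨∅, halg.empty_mem⟩
  have heA : ∀ k, MeasurableSet (e k) := fun k => by
    rw [← hgen]
    exact MeasurableSpace.measurableSet_generateFrom (he ▸ Set.mem_range_self k)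
  let W : Ω → ℕ → ℝ≥0∞ := fun ω k => M ω (e k)
  refine ⟨W, ?_, fun A hA => ⟨fun ω => (M ω).real A, ?_, hMA A hA⟩⟩
  · exact @measurable_pi_lambda _ _ _ m _ W fun k => (Measure.measurable_coe (heA k)).comp hMm
  · have hMW : Measurable[MeasurableSpace.comap W inferInstance] M := by
      refine @Measurable.measure_of_isPiSystem_of_isProbabilityMeasure Ω Z
        (MeasurableSpace.comap W inferInstance) _ M _ 𝒞 hgen.symm
        (fun s hs t ht _ => halg.inter_mem hs ht) fun s hs => ?_
      rw [he] at hs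
      obtain ⟨k, rfl⟩ := hs
      exact (measurable_pi_apply k).comp (comap_measurable W)
    exact ((Measure.measurable_coe hA).comp hMW).ennreal_toReal.stronglyMeasurable

end CondExp

/-! ### The decoupled sequence of a recursion -/

section Representation

variable {Z R : Type*}

/-- The functions `h_n(x₁, …, x_n)` attached to the recursion driven by `q`: the first component of
the last value of the recursion. -/
def unrollFst (q : (n : ℕ) → (Fin n → Z × R) → I → Z × R) (n : ℕ) (x : Fin (n + 1) → I) : Z :=
  (unroll q (n + 1) x (Fin.last n)).1

lemma unrollFst_snoc (q : (n : ℕ) → (Fin n → Z × R) → I → Z × R) (n : ℕ) (x : Fin n → I) (t : I) :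
    unrollFst q n (Fin.snoc (α := fun _ => I) x t) = (q n (unroll q n x) t).1 := by
  rw [unrollFst, unroll_snoc, Fin.snoc_last]

lemma decoupledSeq_unrollFst (q : (n : ℕ) → (Fin n → Z × R) → I → Z × R)
    (z : (ℕ → I) × (ℕ → I)) (n : ℕ) :
    decoupledSeq (unrollFst q) z n = (q n (initSeg n (unrollSeq q z.1)) (z.2 n)).1 := by
  rw [initSeg_unrollSeq]
  exact unrollFst_snoc q n _ _

variable [MeasurableSpace Z] [MeasurableSpace R]

lemma measurable_unrollFst {q : (n : ℕ) → (Fin n → Z × R) → I → Z × R}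
    (hq : ∀ n, Measurable (Function.uncurry (q n))) (n : ℕ) : Measurable (unrollFst q n) :=
  measurable_fst.comp ((measurable_pi_apply (Fin.last n)).comp (measurable_unroll hq (n + 1)))

lemma measurable_decoupledSeq_unrollFst {q : (n : ℕ) → (Fin n → Z × R) → I → Z × R}
    (hq : ∀ n, Measurable (Function.uncurry (q n))) : Measurable (decoupledSeq (unrollFst q)) := by
  refine measurable_pi_lambda _ fun n => ?_
  simp_rw [decoupledSeq_unrollFst]
  exact measurable_fst.comp ((hq n).comp
    ((((measurable_initSeg n).comp (measurable_unrollSeq hq)).comp measurable_fst).prodMk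
      ((measurable_pi_apply n).comp measurable_snd)))

variable {Ω : Type*} [mΩ : MeasurableSpace Ω] {P : Measure Ω} [IsProbabilityMeasure P]
  [StandardBorelSpace Z] [Nonempty Z] [StandardBorelSpace R] [Nonempty R]

/-- The first component of `q n y t`, with `t` uniform, samples the conditional law of `f n` given
that the past of the sequence `g` is `y`. -/
lemma map_fst_ae_eq_condDistrib {g : ℕ → Ω → Z × R} (hg : ∀ n, Measurable (g n))
    {q : (n : ℕ) → (Fin n → Z × R) → I → Z × R} (hq : ∀ n, Measurable (Function.uncurry (q n)))
    (hqκ : ∀ n y, volume.map (q n y) =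
      condDistrib (g n) (fun ω => initSeg n fun k => g k ω) P y) (n : ℕ) :
    ∀ᵐ y ∂P.map (fun ω => initSeg n fun k => g k ω),
      volume.map (fun t => (q n y t).1) =
        condDistrib (fun ω => (g n ω).1) (fun ω => initSeg n fun k => g k ω) P y := by
  have h := condDistrib_comp (μ := P) (mβ := MeasurableSpace.pi)
    (fun ω => initSeg n fun k => g k ω) (hg n).aemeasurable
    (measurable_fst : Measurable (Prod.fst : Z × R → Z))
  filter_upwards [h] with y hy
  refine Eq.trans ?_ hy.symm
  rw [Kernel.map_apply _ measurable_fst, ← hqκ n y,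
    Measure.map_map measurable_fst (hq n).of_uncurry_left]
  rfl

/-- The law of the decoupled sequence: conditionally on the first family of uniform variables its
terms are independent, with the conditional laws of the `f n` given the past. -/
lemma decoupledSeq_unrollFst_box {g : ℕ → Ω → Z × R} (hg : ∀ n, Measurable (g n))
    {q : (n : ℕ) → (Fin n → Z × R) → I → Z × R} (hq : ∀ n, Measurable (Function.uncurry (q n)))
    (hqκ : ∀ n y, volume.map (q n y) =
      condDistrib (g n) (fun ω => initSeg n fun k => g k ω) P y)
    (N : ℕ) {A : ℕ → Set Z} (hA : ∀ k, MeasurableSet (A k)) :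
    (cubeMeasure.prod cubeMeasure).map (decoupledSeq (unrollFst q))
        {x | ∀ k ∈ Finset.range N, x k ∈ A k} =
      ∫⁻ ω, ∏ k ∈ Finset.range N, condDistrib (fun ω => (g k ω).1)
        (fun ω => initSeg k fun k => g k ω) P (initSeg k fun k => g k ω) (A k) ∂P := by
  have hd := measurable_decoupledSeq_unrollFst hq
  have hqm : ∀ k y, Measurable (fun t => (q k y t).1) := fun k y =>
    measurable_fst.comp (hq k).of_uncurry_left
  have hgm : Measurable (fun ω k => g k ω) := measurable_pi_lambda _ hg
  have hF : Measurable (fun y : ℕ → Z × R => ∏ k ∈ Finset.range N,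
      (volume : Measure I) {t | (q k (initSeg k y) t).1 ∈ A k}) := by
    refine Finset.measurable_prod _ fun k _ => ?_
    have hs : MeasurableSet {p : (Fin k → Z × R) × I | (q k p.1 p.2).1 ∈ A k} :=
      measurable_fst.comp (hq k) (hA k)
    exact (measurable_measure_prodMk_left hs).comp (measurable_initSeg k)
  rw [Measure.map_apply hd (measurableSet_box N hA),
    Measure.prod_apply (hd (measurableSet_box N hA))]
  calc ∫⁻ x, cubeMeasure (Prod.mk x ⁻¹' (decoupledSeq (unrollFst q) ⁻¹'
          {x | ∀ k ∈ Finset.range N, x k ∈ A k})) ∂cubeMeasure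
      = ∫⁻ x, ∏ k ∈ Finset.range N,
          (volume : Measure I) {t | (q k (initSeg k (unrollSeq q x)) t).1 ∈ A k}
            ∂cubeMeasure := by
        refine lintegral_congr fun x => ?_
        refine Eq.trans (congrArg cubeMeasure ?_)
          (cubeMeasure_box N fun k => hqm k (initSeg k (unrollSeq q x)) (hA k))
        ext y
        simp only [Set.mem_preimage, Set.mem_ofPred_eq, decoupledSeq_unrollFst]
    _ = ∫⁻ y, ∏ k ∈ Finset.range N,
          (volume : Measure I) {t | (q k (initSeg k y) t).1 ∈ A k}
            ∂(cubeMeasure.map (unrollSeq q)) :=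
        (lintegral_map hF (measurable_unrollSeq hq)).symm
    _ = ∫⁻ ω, ∏ k ∈ Finset.range N,
          (volume : Measure I) {t | (q k (initSeg k fun k => g k ω) t).1 ∈ A k} ∂P := by
        rw [map_unrollSeq hg hq hqκ, lintegral_map hF hgm]
    _ = _ := by
        refine lintegral_congr_ae ?_
        have h : ∀ k, ∀ᵐ ω ∂P, volume.map (fun t => (q k (initSeg k fun k => g k ω) t).1) =
            condDistrib (fun ω => (g k ω).1) (fun ω => initSeg k fun k => g k ω) P
              (initSeg k fun k => g k ω) := fun k =>
          ae_of_ae_map ((measurable_initSeg k).comp hgm).aemeasurable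
            (map_fst_ae_eq_condDistrib hg hq hqκ k)
        filter_upwards [ae_all_iff.2 h] with ω hω
        refine Finset.prod_congr rfl fun k _ => ?_
        rw [← hω k, Measure.map_apply (hqm k _) (hA k)]
        rfl

end Representation

/-! ### Consequences of condition (C.I.) -/

section ConditionCI

variable {Ω : Type*} [mΩ : MeasurableSpace Ω] {P : Measure Ω} [IsProbabilityMeasure P]

/-- Under condition (C.I.) the expected product of the conditional probabilities given the past is
the joint probability: both are computed by conditioning on `𝒢`. -/
lemma ConditionCI.integral_prod_condExp {S : Type*} [MeasurableSpace S] {ℱ : Filtration ℕ mΩ}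
    {f : ℕ → Ω → S} (hf : ∀ n, Measurable (f n)) (h : ConditionCI P ℱ f) (N : ℕ) {A : ℕ → Set S}
    (hA : ∀ k, MeasurableSet (A k)) :
    ∫ ω, ∏ k ∈ Finset.range N, (P[indIn (f k) (A k) | ℱ k]) ω ∂P =
      P.real {ω | ∀ k ∈ Finset.range N, f k ω ∈ A k} := by
  have hbox : MeasurableSet {ω | ∀ k ∈ Finset.range N, f k ω ∈ A k} :=
    measurable_pi_lambda (fun ω k => f k ω) hf (measurableSet_box N hA)
  obtain ⟨𝒢, h𝒢, h1, h2⟩ := h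
  have hprod : (fun ω => ∏ k ∈ Finset.range N, indIn (f k) (A k) ω) =
      {ω | ∀ k ∈ Finset.range N, f k ω ∈ A k}.indicator 1 := by
    classical
    funext ω
    simp only [indIn, Set.indicator_apply, Set.mem_preimage, Set.mem_ofPred_eq, Pi.one_apply]
    rw [Finset.prod_ite_zero]
    simp
  calc ∫ ω, ∏ k ∈ Finset.range N, (P[indIn (f k) (A k) | ℱ k]) ω ∂P
      = ∫ ω, ∏ k ∈ Finset.range N, (P[indIn (f k) (A k) | 𝒢]) ω ∂P := by
        refine integral_congr_ae ?_
        filter_upwards [ae_all_iff.2 fun k => h1 k (A k) (hA k)] with ω hω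
        exact Finset.prod_congr rfl fun k _ => hω k
    _ = ∫ ω, (P[fun ω => ∏ k ∈ Finset.range N, indIn (f k) (A k) ω | 𝒢]) ω ∂P :=
        integral_congr_ae (h2 N A hA).symm
    _ = ∫ ω, ∏ k ∈ Finset.range N, indIn (f k) (A k) ω ∂P := integral_condExp h𝒢
    _ = _ := by
        rw [hprod]
        exact integral_indicator_one hbox

/-- The sequence `(f_{n+1}, W_{n+2})`, where `W_{n+2}` determines the conditional law of `f_{n+2}`
given `ℱ_{n+1}`, carries enough information: conditioning `f_{n+1}` on the past of this sequence
is the same as conditioning it on `ℱ_n`. -/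
lemma condExp_comap_initSeg_ae_eq {Z R : Type*} [MeasurableSpace Z] [MeasurableSpace R]
    {ℱ : Filtration ℕ mΩ} (hℱ : IsTrivialField P (ℱ 0)) {f : ℕ → Ω → Z} {W : ℕ → Ω → R}
    (hf : ∀ n, Measurable (f n))
    {A : Set Z} (hA : MeasurableSet A)
    (hW : ∀ n, ∃ X : Ω → ℝ, StronglyMeasurable[MeasurableSpace.comap (W n) inferInstance] X ∧
      X =ᵐ[P] P[indIn (f n) A | ℱ n])
    (n : ℕ) (hpast : Measurable[ℱ n] fun ω => initSeg n fun k => (f k ω, W (k + 1) ω)) :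
    P[indIn (f n) A | MeasurableSpace.comap
        (fun ω => initSeg n fun k => (f k ω, W (k + 1) ω)) inferInstance] =ᵐ[P]
      P[indIn (f n) A | ℱ n] := by
  have hle := measurable_iff_comap_le.1 hpast
  cases n with
  | zero =>
    -- There is no past and no `W` yet: triviality of `ℱ 0` makes the conditional law constant.
    exact condExp_ae_eq_of_le hle (ℱ.le 0) stronglyMeasurable_const
      (hℱ.condExp_ae_eq (ℱ.le 0)
        ((measurable_const.indicator (hf 0 hA)).stronglyMeasurable)).symm
  | succ n =>
    -- `W (n + 1)` is the second component of the last past value.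
    obtain ⟨X, hX, hXA⟩ := hW (n + 1)
    refine condExp_ae_eq_of_le hle (ℱ.le _) (hX.mono ?_) hXA
    rw [← measurable_iff_comap_le]
    have h1 : Measurable fun y : Fin (n + 1) → Z × R => (y (Fin.last n)).2 :=
      measurable_snd.comp (measurable_pi_apply (Fin.last n))
    exact h1.comp (comap_measurable
      (fun ω => initSeg (n + 1) fun k => (f k ω, W (k + 1) ω)))

end ConditionCI

/-! ### Representation in standard Borel spaces -/

section StandardBorel

variable {Ω : Type*} [mΩ : MeasurableSpace Ω] {P : Measure Ω} [IsProbabilityMeasure P]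

/-- The representation in a standard Borel space. Moreover the law of `h_n(x₁, …, x_{n-1}, ·)` is
the conditional law of `f_n` given some `ℱ_{n-1}`-measurable `X`, evaluated at a copy
`G(x₁, …, x_{n-1})` of `X`. -/
theorem ConditionCI.exists_representsCI {Z : Type*} [MeasurableSpace Z] [StandardBorelSpace Z]
    [Nonempty Z] {ℱ : Filtration ℕ mΩ} (hℱ : IsTrivialField P (ℱ 0)) {f : ℕ → Ω → Z}
    (hf : IsAdaptedSeq ℱ f) (hCI : ConditionCI P ℱ f) :
    ∃ h : (n : ℕ) → (Fin (n + 1) → I) → Z, RepresentsCI P f h ∧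
      ∀ n : ℕ, ∃ (X : Ω → Fin n → Z × (ℕ → ℝ≥0∞)) (G : (Fin n → I) → Fin n → Z × (ℕ → ℝ≥0∞)),
        Measurable[ℱ n] X ∧ Measurable G ∧ volume.map G = P.map X ∧
        ∀ᵐ x : Fin n → I, volume.map (fun t => h n (Fin.snoc (α := fun _ => I) x t)) =
          condDistrib (f n) X P (G x) := by
  have hfm : ∀ n, Measurable (f n) := fun n => (hf n).mono (ℱ.le _) le_rfl
  choose W hWm hW using fun n => exists_measurable_code (P := P) (ℱ.le n) (hfm n)
  -- The shift makes `g n` measurable for `ℱ (n + 1)` and puts `W n`, for `n > 0`, into the past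
  -- of `g n`.
  let g : ℕ → Ω → Z × (ℕ → ℝ≥0∞) := fun n ω => (f n ω, W (n + 1) ω)
  have hga : ∀ n, Measurable[ℱ (n + 1)] (g n) := fun n =>
    (hf n).prodMk (hWm (n + 1))
  have hg : ∀ n, Measurable (g n) := fun n => (hga n).mono (ℱ.le _) le_rfl
  have hpast : ∀ n, Measurable[ℱ n] fun ω => initSeg n fun k => g k ω := fun n =>
    @measurable_pi_lambda _ _ _ (ℱ n) _ _ fun i => (hga i).mono (ℱ.mono i.2) le_rfl
  choose q hq hqκ using fun n => Kernel.exists_measurable_map_eq_unitInterval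
    (condDistrib (g n) (fun ω => initSeg n fun k => g k ω) P)
  have hlift : Measurable (liftSeq (unrollFst q)) := by
    refine measurable_pi_lambda _ fun n => ?_
    exact measurable_fst.comp ((measurable_pi_apply n).comp (measurable_unrollSeq hq))
  have hgseq : Measurable (fun ω k => g k ω) := measurable_pi_lambda _ hg
  have hfseq : Measurable (fun ω n => f n ω) := measurable_pi_lambda _ hfm
  have hpast' : ∀ n, Measurable fun ω => initSeg n fun k => g k ω := fun n =>
    (measurable_initSeg n).comp hgseq
  refine ⟨unrollFst q, ⟨measurable_unrollFst hq, ?_, ?_⟩, fun n => ?_⟩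
  · refine ⟨hfseq.aemeasurable, hlift.aemeasurable, ?_⟩
    have hfst : Measurable (fun (y : ℕ → Z × (ℕ → ℝ≥0∞)) n => (y n).1) :=
      measurable_pi_lambda _ fun n => measurable_fst.comp (measurable_pi_apply n)
    have h := congrArg (Measure.map fun (y : ℕ → Z × (ℕ → ℝ≥0∞)) n => (y n).1)
      (map_unrollSeq hg hq hqκ)
    rw [Measure.map_map hfst (measurable_unrollSeq hq), Measure.map_map hfst hgseq] at h
    exact h.symm
  · have hd := measurable_decoupledSeq_unrollFst hq
    refine ⟨hfseq.aemeasurable, hd.aemeasurable, ?_⟩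
    have : IsProbabilityMeasure (P.map fun ω n => f n ω) :=
      Measure.isProbabilityMeasure_map hfseq.aemeasurable
    refine ext_of_forall_box fun N A hA => ?_
    rw [decoupledSeq_unrollFst_box hg hq hqκ N hA,
      Measure.map_apply hfseq (measurableSet_box N hA)]
    have hK : ∀ k, (fun ω => (condDistrib (f k) (fun ω => initSeg k fun k => g k ω) P
        (initSeg k fun k => g k ω)).real (A k)) =ᵐ[P] P[indIn (f k) (A k) | ℱ k] := fun k =>
      (condDistrib_ae_eq_condExp (hpast' k) (hfm k) (hA k)).trans
        (condExp_comap_initSeg_ae_eq hℱ hfm (hA k) (fun n => hW n _ (hA k)) k (hpast k))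
    have hint : Integrable (fun ω => ∏ k ∈ Finset.range N,
        (condDistrib (f k) (fun ω => initSeg k fun k => g k ω) P
          (initSeg k fun k => g k ω)).real (A k)) P := by
      refine Integrable.of_bound (C := 1) (Measurable.aestronglyMeasurable ?_) ?_
      · exact Finset.measurable_prod _ fun k _ =>
          ((Kernel.measurable_coe _ (hA k)).comp (hpast' k)).ennreal_toReal
      · refine Filter.Eventually.of_forall fun ω => ?_
        rw [Real.norm_of_nonneg (Finset.prod_nonneg fun _ _ => measureReal_nonneg)]
        exact Finset.prod_le_one (fun _ _ => measureReal_nonneg) fun _ _ => measureReal_le_one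
    have hreal := hCI.integral_prod_condExp hfm N hA
    calc P {ω | ∀ k ∈ Finset.range N, f k ω ∈ A k}
        = ENNReal.ofReal (∫ ω, ∏ k ∈ Finset.range N,
            (condDistrib (f k) (fun ω => initSeg k fun k => g k ω) P
              (initSeg k fun k => g k ω)).real (A k) ∂P) := by
          rw [← ofReal_measureReal, ← hreal]
          congr 1
          refine integral_congr_ae ?_
          filter_upwards [ae_all_iff.2 hK] with ω hω
          exact Finset.prod_congr rfl fun k _ => (hω k).symm
      _ = _ := by
          rw [ofReal_integral_eq_lintegral_ofReal hint (Filter.Eventually.of_forall fun ω =>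
            Finset.prod_nonneg fun _ _ => measureReal_nonneg)]
          refine lintegral_congr fun ω => ?_
          rw [ENNReal.ofReal_prod_of_nonneg fun _ _ => measureReal_nonneg]
          exact Finset.prod_congr rfl fun k _ => ofReal_measureReal
  · refine ⟨fun ω => initSeg n fun k => g k ω, unroll q n, hpast n, measurable_unroll hq n,
      map_unroll hg hq hqκ n, ?_⟩
    have h := map_fst_ae_eq_condDistrib hg hq hqκ n
    rw [← map_unroll hg hq hqκ n] at h
    filter_upwards [ae_of_ae_map (measurable_unroll hq n).aemeasurable h] with x hx
    simp_rw [unrollFst_snoc]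
    exact hx

end StandardBorel

/-! ### Conditional centring -/

section Martingale

variable {Ω : Type*} {m mΩ : MeasurableSpace Ω} {P : Measure Ω} [IsProbabilityMeasure P]
  {E : Type*} [NormedAddCommGroup E] [NormedSpace ℝ E] [CompleteSpace E]
  [SecondCountableTopology E] [MeasurableSpace E] [BorelSpace E]
  {Y : Type*} [MeasurableSpace Y]

/-- If `Z` is centred given a σ-field `m` and `X` is `m`-measurable, then almost every conditional
law of `Z` given `X` has a first moment and is centred. -/
lemma ae_integral_condDistrib_eq_zero (hm : m ≤ mΩ) {Z : Ω → E}
    (hZ : Integrable Z P) (hZ0 : P[Z | m] =ᵐ[P] 0) {X : Ω → Y} (hX : Measurable[m] X) :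
    ∀ᵐ y ∂P.map X, Integrable id (condDistrib Z X P y) ∧ ∫ z, z ∂condDistrib Z X P y = 0 := by
  have hX' : Measurable X := hX.mono hm le_rfl
  have hint : Integrable (fun p : Y × E => p.2) (P.map fun ω => (X ω, Z ω)) :=
    (integrable_map_measure (f := fun ω => (X ω, Z ω)) (measurable_snd.aestronglyMeasurable)
      (hX'.aemeasurable.prodMk hZ.1.aemeasurable)).2 hZ
  have h0 : (fun ω => ∫ z, z ∂condDistrib Z X P (X ω)) =ᵐ[P] 0 := by
    have h1 := condExp_ae_eq_integral_condDistrib' (μ := P) hX' hZ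
    have h2 : P[P[Z | m] | MeasurableSpace.comap X inferInstance] =ᵐ[P]
        P[Z | MeasurableSpace.comap X inferInstance] :=
      condExp_condExp_of_le (measurable_iff_comap_le.1 hX) hm
    have h3 := condExp_congr_ae (m := MeasurableSpace.comap X inferInstance) hZ0
    rw [condExp_zero] at h3
    exact h1.symm.trans (h2.symm.trans h3)
  have hsm : StronglyMeasurable fun y => ∫ z, z ∂condDistrib Z X P y :=
    StronglyMeasurable.integral_condDistrib (f := fun p : Y × E => p.2)
      measurable_snd.stronglyMeasurable
  have h0' : ∀ᵐ y ∂P.map X, ∫ z, z ∂condDistrib Z X P y = 0 :=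
    (ae_map_iff hX'.aemeasurable (hsm.measurable (measurableSet_singleton 0))).2 h0
  filter_upwards [hint.condDistrib_ae_map hZ.1.aemeasurable, h0'] with y h1 h2
  exact ⟨h1, h2⟩

end Martingale

/-! ### Transfer to countably generated spaces -/

section Perfect

/-- In a countably generated space the σ-field is that of a single real function. -/
lemma exists_real_comap_eq (S : Type*) [mS : MeasurableSpace S]
    [MeasurableSpace.CountablyGenerated S] :
    ∃ φ : S → ℝ, MeasurableSpace.comap φ inferInstance = mS := by
  have h1 : MeasurableSpace.comap (MeasurableSpace.mapNatBool S) inferInstance = mS := by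
    refine le_antisymm (MeasurableSpace.measurable_mapNatBool S).comap_le ?_
    conv_lhs => rw [← MeasurableSpace.generateFrom_natGeneratingSequence S]
    refine MeasurableSpace.generateFrom_le ?_
    rintro _ ⟨n, rfl⟩
    refine ⟨(fun x => x n) ⁻¹' {true},
      measurable_pi_apply n (measurableSet_singleton true), ?_⟩
    ext x
    simp [MeasurableSpace.mapNatBool]
  refine ⟨embeddingReal (ℕ → Bool) ∘ MeasurableSpace.mapNatBool S, ?_⟩
  rw [← MeasurableSpace.comap_comp, (measurableEmbedding_embeddingReal (ℕ → Bool)).comap_eq, h1]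

/-- For a perfect law `μ` the map `φ` has a measurable section, defined almost everywhere for the
image of `μ`, when `φ` generates the σ-field. -/
lemma IsPerfectMeasure.exists_section {S : Type*} [mS : MeasurableSpace S] {μ : Measure S}
    [IsProbabilityMeasure μ] (hμ : IsPerfectMeasure μ) {φ : S → ℝ}
    (hφ : MeasurableSpace.comap φ inferInstance = mS) :
    ∃ ψ : ℝ → S, Measurable ψ ∧ ∀ᵐ s ∂μ, φ (ψ (φ s)) = φ s := by
  classical
  have hφm : Measurable φ := by rw [← hφ]; exact comap_measurable φ
  obtain ⟨B, hB, hBr, hB0⟩ := hμ φ hφm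
  have : Nonempty S := μ.nonempty_of_neZero
  -- Off `B` the section takes a fixed value, so that only measurability of `B` matters there.
  let s₀ : S := Classical.arbitrary S
  let ψ : ℝ → S := fun r => if r ∈ B then Function.invFun φ r else s₀
  have hψ : ∀ r ∈ B, φ (ψ r) = r := fun r hr => by
    simp only [ψ, hr, if_true]
    exact Function.invFun_eq (hBr hr)
  refine ⟨ψ, ?_, ?_⟩
  · rw [← hφ, measurable_comap_iff]
    have : φ ∘ ψ = fun r => if r ∈ B then r else φ s₀ := by
      funext r
      by_cases hr : r ∈ B
      · simp [hr, hψ r hr]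
      · simp [ψ, hr]
    rw [this]
    exact Measurable.ite hB measurable_id measurable_const
  · have : ∀ᵐ s ∂μ, s ∉ φ ⁻¹' Bᶜ := measure_eq_zero_iff_ae_notMem.1 hB0
    filter_upwards [this] with s hs
    exact hψ _ (by simpa using hs)

/-- Random sequences in a space whose σ-field is generated by `φ` have the same law if their images
under `φ` agree almost surely. -/
lemma map_eq_of_ae_eq_comp {Ω S : Type*} [MeasurableSpace Ω] {P : Measure Ω}
    [mS : MeasurableSpace S] {φ : S → ℝ} (hφ : MeasurableSpace.comap φ inferInstance = mS)
    {f g : Ω → ℕ → S} (hf : Measurable f) (hg : Measurable g)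
    (h : ∀ᵐ ω ∂P, ∀ n, φ (f ω n) = φ (g ω n)) : P.map f = P.map g := by
  have hpi : (MeasurableSpace.pi : MeasurableSpace (ℕ → S)) =
      MeasurableSpace.comap (fun x n => φ (x n))
        (MeasurableSpace.pi : MeasurableSpace (ℕ → ℝ)) := by
    simp only [MeasurableSpace.pi, MeasurableSpace.comap_iSup, MeasurableSpace.comap_comp, ← hφ]
    rfl
  ext s hs
  rw [Measure.map_apply hf hs, Measure.map_apply hg hs]
  rw [hpi] at hs
  obtain ⟨t, -, rfl⟩ := hs
  refine measure_congr ?_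
  filter_upwards [h] with ω hω
  have : (fun n => φ (f ω n)) = fun n => φ (g ω n) := funext hω
  change ((fun n => φ (f ω n)) ∈ t) = ((fun n => φ (g ω n)) ∈ t)
  rw [this]

variable {Ω S : Type*} [mΩ : MeasurableSpace Ω] [MeasurableSpace S]

lemma IsAdaptedSeq.comp {S' : Type*} [MeasurableSpace S'] {ℱ : Filtration ℕ mΩ} {f : ℕ → Ω → S}
    (hf : IsAdaptedSeq ℱ f) {φ : S → S'} (hφ : Measurable φ) :
    IsAdaptedSeq ℱ fun n ω => φ (f n ω) :=
  fun n => hφ.comp (hf n)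

lemma ConditionCI.comp {S' : Type*} [MeasurableSpace S'] {P : Measure Ω} {ℱ : Filtration ℕ mΩ}
    {f : ℕ → Ω → S} (hf : ConditionCI P ℱ f) {φ : S → S'} (hφ : Measurable φ) :
    ConditionCI P ℱ fun n ω => φ (f n ω) := by
  obtain ⟨𝒢, h𝒢, h1, h2⟩ := hf
  exact ⟨𝒢, h𝒢, fun n A hA => h1 n (φ ⁻¹' A) (hφ hA),
    fun n A hA => h2 n (fun k => φ ⁻¹' A k) fun k => hφ (hA k)⟩

/-- A representation of the real sequence `φ (f_n)` is pulled back to one of `f_n` by almost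
everywhere sections `ψ n` of `φ`. -/
lemma RepresentsCI.of_sections {P : Measure Ω} {f : ℕ → Ω → S} (hf : ∀ n, Measurable (f n))
    {φ : S → ℝ} (hφ : MeasurableSpace.comap φ inferInstance = ‹MeasurableSpace S›)
    {h : (n : ℕ) → (Fin (n + 1) → I) → ℝ} (hh : RepresentsCI P (fun n ω => φ (f n ω)) h)
    {ψ : ℕ → ℝ → S} (hψ : ∀ n, Measurable (ψ n))
    (hψφ : ∀ᵐ ω ∂P, ∀ n, φ (ψ n (φ (f n ω))) = φ (f n ω)) :
    RepresentsCI P f fun n x => ψ n (h n x) := by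
  have hφm : Measurable φ := by rw [← hφ]; exact comap_measurable φ
  obtain ⟨h1, h2, h3⟩ := hh
  have hΨ : Measurable fun (y : ℕ → ℝ) n => ψ n (y n) :=
    measurable_pi_lambda _ fun n => (hψ n).comp (measurable_pi_apply n)
  have hfseq : Measurable fun ω n => f n ω := measurable_pi_lambda _ hf
  have hψf : Measurable fun ω n => ψ n (φ (f n ω)) :=
    measurable_pi_lambda _ fun n => (hψ n).comp (hφm.comp (hf n))
  have h0 : IdentDistrib (fun ω n => f n ω) (fun ω n => ψ n (φ (f n ω))) P P :=
    ⟨hfseq.aemeasurable, hψf.aemeasurable,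
      map_eq_of_ae_eq_comp hφ hfseq hψf (hψφ.mono fun ω hω n => (hω n).symm)⟩
  exact ⟨fun n => (hψ n).comp (h1 n), h0.trans (h2.comp hΨ), h0.trans (h3.comp hΨ)⟩

end Perfect

/-! ### The representation theorem -/

theorem theorem5p1 {Ω : Type*} [mΩ : MeasurableSpace Ω] (P : Measure Ω) [IsProbabilityMeasure P]
    (ℱ : Filtration ℕ mΩ) (hℱ : IsTrivialField P (ℱ 0)) :
    (∀ (S : Type*) [MeasurableSpace S] [MeasurableSpace.CountablyGenerated S] (f : ℕ → Ω → S),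
      IsAdaptedSeq ℱ f → (∀ n, IsPerfectMeasure (P.map (f n))) → ConditionCI P ℱ f →
      ∃ h : (n : ℕ) → (Fin (n + 1) → unitInterval) → S, RepresentsCI P f h) ∧
    (∀ (E : Type*) [NormedAddCommGroup E] [NormedSpace ℝ E] [CompleteSpace E]
      [TopologicalSpace.SeparableSpace E] [MeasurableSpace E] [BorelSpace E] (f : ℕ → Ω → E),
      IsAdaptedSeq ℱ f → ConditionCI P ℱ f →
      ∃ h : (n : ℕ) → (Fin (n + 1) → unitInterval) → E, RepresentsCI P f h ∧
        (IsMartingaleDifference P ℱ f →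
          ∀ n : ℕ, ∀ᵐ x : Fin n → unitInterval,
            Integrable (fun t : unitInterval =>
              h n (Fin.snoc (α := fun _ => unitInterval) x t)) ∧
            ∫ t : unitInterval, h n (Fin.snoc (α := fun _ => unitInterval) x t) = 0)) := by
  refine ⟨fun S _ _ f hf hperf hCI => ?_, fun E _ _ _ _ _ _ f hf hCI => ?_⟩
  · obtain ⟨φ, hφ⟩ := exists_real_comap_eq S
    have hφm : Measurable φ := by rw [← hφ]; exact comap_measurable φ
    have hfm : ∀ n, Measurable (f n) := fun n => (hf n).mono (ℱ.le _) le_rfl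
    have hprob : ∀ n, IsProbabilityMeasure (P.map (f n)) := fun n =>
      Measure.isProbabilityMeasure_map (hfm n).aemeasurable
    obtain ⟨h, hh, -⟩ := (hCI.comp hφm).exists_representsCI hℱ (hf.comp hφm)
    choose ψ hψ hψφ using fun n => (hperf n).exists_section hφ
    exact ⟨_, hh.of_sections hfm hφ hψ
      (ae_all_iff.2 fun n => ae_of_ae_map (hfm n).aemeasurable (hψφ n))⟩
  · have : SecondCountableTopology E := UniformSpace.secondCountable_of_separable E
    obtain ⟨h, hh, hlaw⟩ := hCI.exists_representsCI hℱ hf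
    refine ⟨h, hh, fun hmart n => ?_⟩
    obtain ⟨X, G, hX, hG, hGX, hx⟩ := hlaw n
    have hc := ae_integral_condDistrib_eq_zero (ℱ.le n) (hmart.2 n).1 (hmart.2 n).2 hX
    rw [← hGX] at hc
    filter_upwards [hx, ae_of_ae_map hG.aemeasurable hc] with x hx1 hx2
    have hm : Measurable fun t : I => h n (Fin.snoc (α := fun _ => I) x t) :=
      (hh.1 n).comp ((measurable_snoc n).comp measurable_prodMk_left)
    rw [← hx1] at hx2
    exact ⟨(integrable_map_measure measurable_id.aestronglyMeasurable hm.aemeasurable).1 hx2.1,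
      (integral_map hm.aemeasurable measurable_id.aestronglyMeasurable).symm.trans hx2.2⟩
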